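/- Conventions: all spaces are Tychonoff. An open $\omega$-cover of a space $X$ is a family $\mathcal U$ of open subsets of $X$ with $X\notin\mathcal U$ such that every finite subset of $X$ is contained in a member of $\mathcal U$; $\Omega$ denotes the family of all open $\omega$-covers of the space under consideration. A space has property $S_1(\Omega,\Omega)$ if for every sequence $(\mathcal U_n)_{n\in\mathbb N}$ of open $\omega$-covers there are $U_n\in\mathcal U_n$ such that $\{U_n:n\in\mathbb N\}$ is an open $\omega$-cover; a space $X$ is projectively $S_1(\Omega,\Omega)$ if every second countable (Tychonoff) continuous image of $X$ has property $S_1(\Omega,\Omega)$. A space $Z$ is $R$-separable if for every sequence $(D_n)_{n\in\mathbb N}$ of dense subsets of $Z$ there are $p_n\in D_n$ such that $\{p_n:n\in\mathbb N\}$ is dense in $Z$. $C_p(X)$ is the space of continuous functions $X\to\mathbb R$ with the topology of pointwise convergence. Theorem. Assume the Continuum Hypothesis, $2^{\aleph_0}=\aleph_1$. Then there is a Tychonoff space $X$ such that (1) $X$ has a coarser second countable (Tychonoff) topology; (2) $X$ is projectively $S_1(\Omega,\Omega)$; (3) $X$ does not have property $S_1(\Omega,\Omega)$; (4) $C_p(X)$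 is not $R$-separable; (5) every countable dense subspace of $C_p(X)$ is $R$-separable; (6) $C_p(X)$ has a countable dense $R$-separable subspace. In particular, by (4) and (6), the following question of Bella, Bonanzinga and Matveev (their Question 64) has a positive answer under the Continuum Hypothesis: does there exist a space $X$ such that $C_p(X)$ is not $R$-separable but contains a dense $R$-separable subspace? -/

import Mathlib

open Set

universe u

/-- The selection hypothesis `S₁(𝒜, ℬ)`: from every sequence of members of `𝒜` one can select
one element of each so that the set of selected elements belongs to `ℬ`. -/
def S1 {α : Type u} (𝒜 ℬ : Set (Set α)) : Prop :=
  ∀ A : ℕ → Set α, (∀ n, A n ∈ 𝒜) → ∃ b : ℕ → α, (∀ n, b n ∈ A n) ∧ range b ∈ ℬ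

/-- `Ω`: the family of all (nontrivial) open `ω`-covers of `X`. -/
def OpenOmegaCovers (X : Type u) [TopologicalSpace X] : Set (Set (Set X)) :=
  {𝒰 | (∀ U ∈ 𝒰, IsOpen U) ∧ univ ∉ 𝒰 ∧ ∀ F : Set X, F.Finite → ∃ U ∈ 𝒰, F ⊆ U}

/-- The space `X` has the property `S₁(Ω, Ω)`. -/
def IsS1OmegaOmega (X : Type u) [TopologicalSpace X] : Prop :=
  S1 (OpenOmegaCovers X) (OpenOmegaCovers X)

/-- `X` is projectively `S₁(Ω, Ω)`: every second countable (Tychonoff) continuous image of `X`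
has the property `S₁(Ω, Ω)`. -/
def IsProjectivelyS1OmegaOmega (X : Type u) [TopologicalSpace X] : Prop :=
  ∀ (Y : Type u) [TopologicalSpace Y] [T35Space Y] [SecondCountableTopology Y] (f : X → Y),
    Continuous f → Function.Surjective f → IsS1OmegaOmega Y

/-- `X` has a coarser second countable (Tychonoff) topology. In Mathlib's order on topologies,
`τ ≤ σ` says that `σ` is coarser than `τ`. -/
def HasCoarserSecondCountableTopology (X : Type u) [τ : TopologicalSpace X] : Prop :=
  ∃ σ : TopologicalSpace X, τ ≤ σ ∧ @T35Space X σ ∧ @SecondCountableTopology X σ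

/-- `C_p(X)`: the continuous real-valued functions on `X` with the topology of pointwise
convergence, that is, the subspace topology inherited from the product `X → ℝ`. -/
abbrev Cp (X : Type u) [TopologicalSpace X] : Type u := {f : X → ℝ // Continuous f}

/-- `Z` is `R`-separable: it satisfies `S₁(𝒟, 𝒟)` for the family `𝒟` of its dense subsets. -/
def RSeparable (Z : Type u) [TopologicalSpace Z] : Prop :=
  S1 {D : Set Z | Dense D} {D : Set Z | Dense D}

/-! The space is a Cantor tree: countably many isolated nodes and an uncountable set `Z` of
branches, each the limit of its restrictions. The ω-cover by the sets "all nodes plus finitely many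
points" has no countable ω-subcover, so S₁(Ω, Ω) fails, and with it R-separability of C_p
(`RSeparable.isS1OmegaOmega`).

In a second countable image, regularity replaces covers by countable families of open sets, and the
density of the nodes reduces these to their traces, which are sets of nodes. The projective property
thus follows from `SelectiveBranches Z`, a statement about only continuum many sequences of
families. CH lists these sequences with countable initial segments, and `Z` is built by transfinite
recursion, each new branch lying in countably many prescribed dense open sets. This genericity acts
twice. A listed set that almost contains a later branch contains a whole cone around it, so the
families to be treated contain cones above arbitrary nodes (`capturing_of_requirements`). Then a
selection that works for the countably many points of one stage keeps working for every later branch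
(`Capturing.exists_captures`).

A countable dense `M` in C_p(X) only sees the image of `X` in `ℝ^M`, which is second countable;
S₁(Ω, Ω) of this image gives strong fan tightness and hence R-separability of `M`. Such an `M`
exists because the tree injects continuously into a compact metrizable space. -/

open Filter Topology

/-! ### The Cantor tree: nodes, branches and almost inclusion -/


/-- Nodes of the Cantor tree; the restriction of a branch `x` to `n` is `PiNat.res x n`, which
lists the first `n` values in reverse order, so that the tree order is `<:+`. -/
abbrev Node := List Bool

/-- Branches of the Cantor tree. -/
abbrev Branch := ℕ → Bool

/-- A set of nodes almost contains a node if it contains it, and almost contains a branch if it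
contains all but finitely many of its restrictions. -/
def AlmostIn (a : Set Node) : Node ⊕ Branch → Prop
  | .inl t => t ∈ a
  | .inr x => ∀ᶠ k in atTop, PiNat.res x k ∈ a

/-- The nodes above `t`. -/
def cone (t : Node) : Set Node := {u | t <:+ u}

theorem AlmostIn.mono {a b : Set Node} (h : a ⊆ b) : ∀ {p : Node ⊕ Branch}, AlmostIn a p →
    AlmostIn b p
  | .inl _, hp => h hp
  | .inr _, hp => Filter.Eventually.mono hp fun _ hk => h hk

theorem PiNat.res_suffix_res {α : Type*} (x : ℕ → α) {j k : ℕ} (h : j ≤ k) :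
    PiNat.res x j <:+ PiNat.res x k := by
  induction k, h using Nat.le_induction with
  | base => exact List.suffix_rfl
  | succ k _ ih => exact ih.trans (List.suffix_cons _ _)

theorem PiNat.suffix_res_iff {α : Type*} (x : ℕ → α) {s : List α} {k : ℕ} (h : s.length ≤ k) :
    s <:+ PiNat.res x k ↔ PiNat.res x s.length = s := by
  constructor
  · intro hs
    have := List.suffix_of_suffix_length_le (PiNat.res_suffix_res x h) hs (by simp)
    exact this.eq_of_length (by simp)
  · intro hs
    have := PiNat.res_suffix_res x h
    rwa [hs] at this

theorem PiNat.exists_res_eq {α : Type*} [Nonempty α] (s : List α) :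
    ∃ x : ℕ → α, PiNat.res x s.length = s := by
  induction s with
  | nil => exact ⟨fun _ => Classical.arbitrary α, rfl⟩
  | cons b s ih =>
    obtain ⟨x, hx⟩ := ih
    refine ⟨Function.update x s.length b, ?_⟩
    have : PiNat.res (Function.update x s.length b) s.length = s := by
      rw [← hx, PiNat.res_length, hx]
      refine (PiNat.res_eq_res.2 fun m hm => ?_).trans hx
      exact Function.update_of_ne hm.ne _ _
    simp [this]

theorem almostIn_cone {x : Branch} {j : ℕ} : AlmostIn (cone (PiNat.res x j)) (.inr x) :=
  (eventually_ge_atTop j).mono fun _ hk => PiNat.res_suffix_res x hk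

theorem isOpen_setOf_res_eq (x : Branch) (n : ℕ) :
    IsOpen {y : Branch | PiNat.res y n = PiNat.res x n} := by
  rw [← PiNat.cylinder_eq_res]
  exact PiNat.isOpen_cylinder _ x n

theorem isOpen_setOf_exists_res (Q : ℕ → Node → Prop) :
    IsOpen {x : Branch | ∃ j, Q j (PiNat.res x j)} := by
  rw [isOpen_iff_mem_nhds]
  rintro x ⟨j, hj⟩
  filter_upwards [(isOpen_setOf_res_eq x j).mem_nhds rfl] with y hy
  exact ⟨j, by rwa [hy]⟩

theorem dense_of_forall_node {D : Set Branch}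
    (h : ∀ s : Node, ∃ x ∈ D, PiNat.res x s.length = s) : Dense D := by
  rw [(PiNat.isTopologicalBasis_cylinders fun _ => Bool).dense_iff]
  rintro _ ⟨x, n, rfl⟩ -
  obtain ⟨y, hy, hys⟩ := h (PiNat.res x n)
  rw [PiNat.cylinder_eq_res]
  exact ⟨y, by simpa using hys, hy⟩

/-- Baire category theorem in the space of branches, applied inside the cylinder of `s`. -/
theorem exists_generic_branch (s : Node) {𝒟 : Set (Set Branch)} (h𝒟 : 𝒟.Countable) :
    ∃ x : Branch, PiNat.res x s.length = s ∧ ∀ D ∈ 𝒟, IsOpen D → Dense D → x ∈ D := by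
  have hd : Dense (⋂₀ {D ∈ 𝒟 | IsOpen D ∧ Dense D}) :=
    dense_sInter_of_isOpen (fun D hD => hD.2.1) (h𝒟.mono (sep_subset _ _)) fun D hD => hD.2.2
  obtain ⟨y, hy⟩ := PiNat.exists_res_eq s
  obtain ⟨x, hx, hxD⟩ := hd.exists_mem_open (isOpen_setOf_res_eq y s.length) ⟨y, rfl⟩
  · exact ⟨x, hxD.trans hy, fun D hD h1 h2 => hx D ⟨hD, h1, h2⟩⟩

/-! ### Selecting along a countable set -/

/-- `a` almost contains every point of `F`, and contains a cone above every node of `L`. -/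
def Captures (a : Set Node) (F : Set (Node ⊕ Branch)) (L : Set Node) : Prop :=
  (∀ p ∈ F, AlmostIn a p) ∧ ∀ s ∈ L, ∃ t, s <:+ t ∧ cone t ⊆ a

/-- Each of the families `𝒜 n` captures all finite subsets of `S` and all finite sets of nodes. -/
def Capturing (𝒜 : ℕ → ℕ → Set Node) (S : Set (Node ⊕ Branch)) : Prop :=
  ∀ n F, F.Finite → F ⊆ S → ∀ L : Set Node, L.Finite → ∃ i, Captures (𝒜 n i) F L

/-- There are only countably many pairs `(F, L)`; the `n`-th family serves the `n`-th pair. -/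
theorem Capturing.exists_selection {𝒜 : ℕ → ℕ → Set Node} {S : Set (Node ⊕ Branch)}
    (h : Capturing 𝒜 S) (hS : S.Countable) :
    ∃ g : ℕ → ℕ, ∀ F, F.Finite → F ⊆ S → ∀ L : Set Node, L.Finite →
      ∃ n, Captures (𝒜 n (g n)) F L := by
  have hc : ({F : Set (Node ⊕ Branch) | F.Finite ∧ F ⊆ S} ×ˢ
      {L : Set Node | L.Finite ∧ L ⊆ univ}).Countable :=
    (countable_ofPred_finite_subset hS).prod (countable_ofPred_finite_subset countable_univ)
  obtain ⟨e, he⟩ := hc.exists_eq_range ⟨(∅, ∅), by simp⟩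
  have hmem : ∀ n, e n ∈ range e := fun n => mem_range_self n
  simp only [← he] at hmem
  choose g hg using fun n =>
    h n (e n).1 (hmem n).1.1 (hmem n).1.2 (e n).2 (hmem n).2.1
  refine ⟨g, fun F hF hFS L hL => ?_⟩
  have : (F, L) ∈ range e := he ▸ ⟨⟨hF, hFS⟩, hL, subset_univ L⟩
  obtain ⟨n, hn⟩ := this
  have := hg n
  rw [hn] at this
  exact ⟨n, this⟩

open Classical in
/-- A selection as in `Capturing.exists_selection`, when there is one. -/
noncomputable def selection (𝒜 : ℕ → ℕ → Set Node) (S : Set (Node ⊕ Branch)) : ℕ → ℕ :=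
  if h : Capturing 𝒜 S ∧ S.Countable then (h.1.exists_selection h.2).choose else 0

theorem Capturing.selection_spec {𝒜 : ℕ → ℕ → Set Node} {S : Set (Node ⊕ Branch)}
    (h : Capturing 𝒜 S) (hS : S.Countable) {F : Set (Node ⊕ Branch)} (hF : F.Finite) (hFS : F ⊆ S)
    {L : Set Node} (hL : L.Finite) : ∃ n, Captures (𝒜 n (selection 𝒜 S n)) F L := by
  rw [selection, dif_pos ⟨h, hS⟩]
  exact (h.exists_selection hS).choose_spec F hF hFS L hL

/-! ### The dense open sets -/

/-- Branches `x` such that some `b n` captures `F` and `L` and contains a cone around `x`. -/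
def captureSet (b : ℕ → Set Node) (F : Set (Node ⊕ Branch)) (L : Set Node) : Set Branch :=
  {x | ∃ j, ∃ n, Captures (b n) F L ∧ cone (PiNat.res x j) ⊆ b n}

/-- Branches which leave `a` beyond `m`, or have a cone around them contained in `a`. -/
def decideSet (a : Set Node) (m : ℕ) : Set Branch :=
  {x | ∃ j, (m ≤ j ∧ PiNat.res x j ∉ a) ∨ cone (PiNat.res x j) ⊆ a}

theorem isOpen_captureSet (b : ℕ → Set Node) (F : Set (Node ⊕ Branch)) (L : Set Node) :
    IsOpen (captureSet b F L) :=
  isOpen_setOf_exists_res fun _ t => ∃ n, Captures (b n) F L ∧ cone t ⊆ b n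

theorem isOpen_decideSet (a : Set Node) (m : ℕ) : IsOpen (decideSet a m) :=
  isOpen_setOf_exists_res fun j t => (m ≤ j ∧ t ∉ a) ∨ cone t ⊆ a

/-- This is why the cones above `L` are carried along: with `s` added to `L`, the set `b n` contains
a cone above some `t` extending `s`, and every branch through `t` is as required. -/
theorem dense_captureSet {b : ℕ → Set Node} {F : Set (Node ⊕ Branch)} {L : Set Node}
    (h : ∀ s, ∃ n, Captures (b n) F (insert s L)) : Dense (captureSet b F L) := by
  refine dense_of_forall_node fun s => ?_
  obtain ⟨n, hn⟩ := h s
  obtain ⟨t, hst, ht⟩ := hn.2 s (mem_insert _ _)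
  obtain ⟨x, hx⟩ := PiNat.exists_res_eq t
  refine ⟨x, ⟨t.length, n, ⟨hn.1, fun u hu => hn.2 u (mem_insert_of_mem _ hu)⟩, by rwa [hx]⟩, ?_⟩
  rw [← PiNat.suffix_res_iff x hst.length_le, hx]
  exact hst

/-- Above `s`, at a level at least `m`, either a whole cone lies in `a` or some node can be reached
outside `a`. -/
theorem dense_decideSet (a : Set Node) (m : ℕ) : Dense (decideSet a m) := by
  refine dense_of_forall_node fun s => ?_
  obtain ⟨y, hy⟩ := PiNat.exists_res_eq s
  by_cases h : cone (PiNat.res y (max m s.length)) ⊆ a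
  · exact ⟨y, ⟨_, .inr h⟩, hy⟩
  · obtain ⟨t, ht, hta⟩ := not_subset.1 h
    obtain ⟨x, hx⟩ := PiNat.exists_res_eq t
    have hl := ht.length_le
    rw [PiNat.res_length] at hl
    refine ⟨x, ⟨t.length, .inl ⟨(le_max_left _ _).trans hl, by rwa [hx]⟩⟩, ?_⟩
    rw [← PiNat.suffix_res_iff x ((le_max_right _ _).trans hl), hx]
    have h2 := PiNat.res_suffix_res y (le_max_right m s.length)
    rw [hy] at h2
    exact h2.trans ht

theorem exists_cone_of_mem_decideSet {a : Set Node} {x : Branch} (h : ∀ m, x ∈ decideSet a m)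
    (hx : AlmostIn a (.inr x)) : ∃ j, cone (PiNat.res x j) ⊆ a := by
  obtain ⟨m, hm⟩ := eventually_atTop.1 hx
  obtain ⟨j, hj | hj⟩ := h m
  · exact absurd (hm j hj.1) hj.2
  · exact ⟨j, hj⟩

/-- The points of the Cantor tree space over the set `Z` of branches. -/
def treePoints (Z : Set Branch) : Set (Node ⊕ Branch) := range Sum.inl ∪ Sum.inr '' Z

/-- A combinatorial form of `S₁(Ω, Ω)` for the nodes together with the branches in `Z`. -/
def SelectiveBranches (Z : Set Branch) : Prop :=
  ∀ 𝒜 : ℕ → ℕ → Set Node,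
    (∀ n F, F.Finite → F ⊆ treePoints Z → ∃ i, ∀ p ∈ F, AlmostIn (𝒜 n i) p) →
    ∃ g : ℕ → ℕ, ∀ F, F.Finite → F ⊆ treePoints Z → ∃ n, ∀ p ∈ F, AlmostIn (𝒜 n (g n)) p

/-! ### The recursion -/

/-- Transfinite recursion for a condition on stage `i` that looks only at earlier values; `ext`
fills the others arbitrarily, and locality makes them irrelevant. -/
theorem exists_forall_of_local {I Y : Type*} [LinearOrder I] [WellFoundedLT I] [Nonempty Y]
    (Φ : (I → Y) → I → Y → Prop)
    (hloc : ∀ z z' i y, EqOn z z' (Iio i) → Φ z i y → Φ z' i y)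
    (hex : ∀ z i, ∃ y, Φ z i y) : ∃ z : I → Y, ∀ i, Φ z i (z i) := by
  classical
  choose step hstep using hex
  let ext (i : I) (w : ∀ j, j < i → Y) : I → Y :=
    fun j => if h : j < i then w j h else Classical.arbitrary Y
  let z : I → Y := (wellFounded_lt (α := I)).fix fun i w => step (ext i w) i
  have hz : ∀ i, z i = step (ext i fun j _ => z j) i := fun i =>
    (wellFounded_lt (α := I)).fix_eq _ i
  refine ⟨z, fun i => ?_⟩
  refine hloc (ext i fun j _ => z j) z i _ (fun j (hj : j < i) => by simp [ext, hj]) ?_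
  rw [hz]
  exact hstep _ _

section Recursion

variable {I : Type*} [LinearOrder I]

/-- The nodes together with the branches constructed before stage `i`. -/
def stage (z : I → Branch) (i : I) : Set (Node ⊕ Branch) :=
  range Sum.inl ∪ (fun j => Sum.inr (z j)) '' Iio i

/-- The selection made at stage `j` for the sequence `𝒜` of families. -/
noncomputable def stageSelection (𝒜 : ℕ → ℕ → Set Node) (z : I → Branch) (j : I) :
    ℕ → Set Node :=
  fun n => 𝒜 n (selection 𝒜 (stage z j) n)

/-- The sets which the branch constructed at stage `i` has to meet. -/
def requirements (c : I → (ℕ → ℕ → Set Node)) (z : I → Branch) (i : I) : Set (Set Branch) :=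
  -- `Iic`, not `Iio`: the selection of stage `i` knows only the points before `i`, so the branch `z
  -- i` itself must already respect it.
  (⋃ j ∈ Iic i, (fun q => captureSet (stageSelection (c j) z j) q.1 q.2) ''
      ({F | F.Finite ∧ F ⊆ stage z i} ×ˢ {L | L.Finite ∧ L ⊆ univ})) ∪
    (⋃ j ∈ Iic i, range fun q : (ℕ × ℕ) × ℕ => decideSet (c j q.1.1 q.1.2) q.2) ∪
    (fun j => {z j}ᶜ) '' Iio i

theorem stage_congr {z z' : I → Branch} {i : I} (h : EqOn z z' (Iio i)) : stage z i = stage z' i := by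
  unfold stage
  congr 1
  exact image_congr fun j hj => congrArg _ (h hj)

theorem requirements_congr (c : I → (ℕ → ℕ → Set Node)) {z z' : I → Branch} {i : I}
    (h : EqOn z z' (Iio i)) : requirements c z i = requirements c z' i := by
  unfold requirements
  rw [stage_congr h]
  congr 1
  · congr 1
    refine iUnion₂_congr fun j hj => ?_
    unfold stageSelection
    rw [stage_congr (h.mono (Iio_subset_Iio hj))]
  · exact image_congr fun j hj => by rw [h hj]

theorem countable_stage (hI : ∀ i : I, (Iio i).Countable) (z : I → Branch) (i : I) :
    (stage z i).Countable :=
  (countable_range _).union ((hI i).image _)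

theorem countable_requirements (hI : ∀ i : I, (Iio i).Countable) (c : I → (ℕ → ℕ → Set Node))
    (z : I → Branch) (i : I) : (requirements c z i).Countable := by
  have hIic : (Iic i).Countable := by
    rw [← Iio_insert]
    exact (hI i).insert i
  refine ((hIic.biUnion fun j _ => ?_).union (hIic.biUnion fun j _ => countable_range _)).union
    ((hI i).image _)
  exact ((countable_ofPred_finite_subset (countable_stage hI z i)).prod
    (countable_ofPred_finite_subset countable_univ)).image _

theorem exists_branches [WellFoundedLT I] (hI : ∀ i : I, (Iio i).Countable)
    (c : I → (ℕ → ℕ → Set Node)) (s : I → Node) :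
    ∃ z : I → Branch, ∀ i, PiNat.res (z i) (s i).length = s i ∧
      ∀ D ∈ requirements c z i, IsOpen D → Dense D → z i ∈ D := by
  refine exists_forall_of_local (fun z i x => PiNat.res x (s i).length = s i ∧
      ∀ D ∈ requirements c z i, IsOpen D → Dense D → x ∈ D) ?_ ?_
  · intro z z' i y h hy
    rwa [← requirements_congr c h]
  · exact fun z i => exists_generic_branch (s i) (countable_requirements hI c z i)

variable {c : I → (ℕ → ℕ → Set Node)} {z : I → Branch}

theorem mem_captureSet_of_requirements
    (hz : ∀ i, ∀ D ∈ requirements c z i, IsOpen D → Dense D → z i ∈ D) {i j : I} (hij : j ≤ i)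
    {F : Set (Node ⊕ Branch)} (hF : F.Finite) (hFi : F ⊆ stage z i)
    {L : Set Node} (hL : L.Finite)
    (h : ∀ s, ∃ n, Captures (stageSelection (c j) z j n) F (insert s L)) :
    z i ∈ captureSet (stageSelection (c j) z j) F L :=
  hz i _ (.inl (.inl (mem_biUnion hij ⟨(F, L), ⟨⟨hF, hFi⟩, hL, subset_univ _⟩, rfl⟩)))
    (isOpen_captureSet _ _ _) (dense_captureSet h)

theorem mem_decideSet_of_requirements
    (hz : ∀ i, ∀ D ∈ requirements c z i, IsOpen D → Dense D → z i ∈ D) {i j : I} (hij : j ≤ i)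
    (n k m : ℕ) : z i ∈ decideSet (c j n k) m :=
  hz i _ (.inl (.inr (mem_biUnion hij ⟨((n, k), m), rfl⟩)))
    (isOpen_decideSet _ _) (dense_decideSet _ _)

theorem injective_of_requirements
    (hz : ∀ i, ∀ D ∈ requirements c z i, IsOpen D → Dense D → z i ∈ D) :
    Function.Injective z := by
  have key : ∀ i j, j < i → z i ≠ z j := by
    intro i j hij
    have hd : Dense ({z j}ᶜ : Set Branch) := by
      refine dense_of_forall_node fun s => ?_
      obtain ⟨x, hx⟩ := PiNat.exists_res_eq s
      -- Flipping the first bit beyond `s` avoids `z j` without leaving the cylinder of `s`.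
      let y := Function.update x s.length (!z j s.length)
      refine ⟨y, fun h => ?_, ?_⟩
      · have := congrFun (show y = z j from h) s.length
        simp [y] at this
      · refine Eq.trans ?_ hx
        exact PiNat.res_eq_res.2 fun m hm => Function.update_of_ne hm.ne _ _
    exact hz i _ (.inr ⟨j, hij, rfl⟩) isOpen_compl_singleton hd
  intro i j h
  rcases lt_trichotomy i j with hij | hij | hij
  · exact absurd h.symm (key j i hij)
  · exact hij
  · exact absurd h (key i j hij)

/-- Induction on `i`. Sets inside stage `j` are handled by the choice of the selection. Otherwise
remove from `F` its latest branch `z m`: the induction hypothesis at `m`, applied to the rest and to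
`L` with any node added, makes the capture set dense, so `z m` belongs to it and one selected set
serves the rest, `L` and `z m` together. -/
theorem Capturing.exists_captures [WellFoundedLT I] (hI : ∀ i : I, (Iio i).Countable)
    (hz : ∀ i, ∀ D ∈ requirements c z i, IsOpen D → Dense D → z i ∈ D) {j : I}
    (hj : Capturing (c j) (stage z j)) (i : I) :
    ∀ F : Set (Node ⊕ Branch), F.Finite → F ⊆ stage z i → ∀ L : Set Node, L.Finite →
      ∃ n, Captures (stageSelection (c j) z j n) F L := by
  induction i using WellFoundedLT.induction with
  | ind i ih =>
    intro F hF hFi L hL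
    by_cases hFj : F ⊆ stage z j
    · exact hj.selection_spec (countable_stage hI z j) hF hFj hL
    let K : Set I := {k | j ≤ k ∧ k < i ∧ (Sum.inr (z k) : Node ⊕ Branch) ∈ F}
    have hK : K.Finite := by
      refine (hF.preimage (f := fun k => (Sum.inr (z k) : Node ⊕ Branch)) ?_).subset fun k hk => hk.2.2
      exact (Sum.inr_injective.comp (injective_of_requirements hz)).injOn
    have hKne : K.Nonempty := by
      obtain ⟨p, hpF, hpj⟩ := not_subset.1 hFj
      rcases hFi hpF with hp | ⟨k, hk, rfl⟩
      · exact absurd (.inl hp) hpj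
      · exact ⟨k, not_lt.1 fun hkj => hpj (.inr ⟨k, hkj, rfl⟩), hk, hpF⟩
    obtain ⟨m, ⟨hjm, hmi, -⟩, hmax⟩ := exists_max_image K id hK hKne
    have hF' : (F \ {Sum.inr (z m)}).Finite := hF.sdiff
    have hF'm : F \ {Sum.inr (z m)} ⊆ stage z m := by
      rintro p ⟨hpF, hpm⟩
      rcases hFi hpF with hp | ⟨k, hk, rfl⟩
      · exact .inl hp
      · refine .inr ⟨k, lt_of_not_ge fun hmk => hpm ?_, rfl⟩
        have : k = m := le_antisymm (hmax k ⟨hjm.trans hmk, hk, hpF⟩) hmk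
        rw [this]
        rfl
    obtain ⟨l, n, hn, hl⟩ := mem_captureSet_of_requirements hz hjm hF' hF'm hL
      fun s => ih m hmi _ hF' hF'm _ (hL.insert s)
    refine ⟨n, fun p hp => ?_, hn.2⟩
    by_cases hpm : p = Sum.inr (z m)
    · rw [hpm]
      exact almostIn_cone.mono hl
    · exact hn.1 p ⟨hp, hpm⟩

/-- To obtain a cone above each node of `L`, enlarge `F` by a branch through that node constructed
at a stage not before `j`. Such a branch decides every set in `c j`, so being almost contained gives
a cone around it. -/
theorem capturing_of_requirements {s : I → Node}
    (hs : ∀ i, PiNat.res (z i) (s i).length = s i) (hs' : ∀ t j, ∃ i, j ≤ i ∧ s i = t)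
    (hz : ∀ i, ∀ D ∈ requirements c z i, IsOpen D → Dense D → z i ∈ D) (j : I)
    (h : ∀ n F, F.Finite → F ⊆ treePoints (range z) →
      ∃ i, ∀ p ∈ F, AlmostIn (c j n i) p) : Capturing (c j) (stage z j) := by
  intro n F hF hFj L hL
  choose e hje he using fun t => hs' t j
  have hsub : stage z j ⊆ treePoints (range z) := by
    rintro p (hp | ⟨k, -, rfl⟩)
    · exact .inl hp
    · exact .inr ⟨_, ⟨k, rfl⟩, rfl⟩
  obtain ⟨k, hk⟩ := h n (F ∪ (fun t => Sum.inr (z (e t))) '' L) (hF.union (hL.image _)) <|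
    union_subset (hFj.trans hsub) (image_subset_iff.2 fun t _ => .inr ⟨_, ⟨e t, rfl⟩, rfl⟩)
  refine ⟨k, fun p hp => hk p (.inl hp), fun t ht => ?_⟩
  obtain ⟨l, hl⟩ := exists_cone_of_mem_decideSet
    (mem_decideSet_of_requirements hz (hje t) n k) (hk _ (.inr ⟨t, ht, rfl⟩))
  -- High enough on the branch to lie both above `t` and inside the cone found at level `l`.
  refine ⟨PiNat.res (z (e t)) (max l t.length), ?_, ?_⟩
  · rw [PiNat.suffix_res_iff _ (le_max_right _ _)]
    have := hs (e t)
    rwa [he] at this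
  · exact fun u hu => hl ((PiNat.res_suffix_res _ (le_max_left _ _)).trans hu)

theorem exists_subset_stage {s : I → Node} [Nonempty I] (hs' : ∀ t j, ∃ i, j ≤ i ∧ s i = t)
    (hinj : Function.Injective z) {F : Set (Node ⊕ Branch)} (hF : F.Finite)
    (hFZ : F ⊆ treePoints (range z)) : ∃ i, F ⊆ stage z i := by
  have hK : {k | (Sum.inr (z k) : Node ⊕ Branch) ∈ F}.Finite :=
    hF.preimage (Sum.inr_injective.comp hinj).injOn
  obtain ⟨m, hm⟩ := hK.bddAbove
  -- Asking for a node different from `s m` forces `i` to be strictly above `m`.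
  obtain ⟨i, hmi, hi⟩ := hs' (true :: s m) m
  have hlt : m < i := lt_of_le_of_ne hmi fun h => by simp [h] at hi
  refine ⟨i, fun p hp => ?_⟩
  rcases hFZ hp with h | ⟨_, ⟨k, rfl⟩, rfl⟩
  · exact .inl h
  · exact .inr ⟨k, (hm hp).trans_lt hlt, rfl⟩

theorem exists_selectiveBranches_of_order [WellFoundedLT I] [Nonempty I]
    (hI : ∀ i : I, (Iio i).Countable) {s : I → Node}
    (hcs : ∀ 𝒜 t, ∃ i, c i = 𝒜 ∧ s i = t) (hs' : ∀ t j, ∃ i, j ≤ i ∧ s i = t) :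
    ∃ z : I → Branch, Function.Injective z ∧ SelectiveBranches (range z) := by
  obtain ⟨z, hz⟩ := exists_branches hI c s
  have hz1 := fun i => (hz i).1
  have hz2 := fun i => (hz i).2
  have hinj := injective_of_requirements hz2
  refine ⟨z, hinj, fun 𝒜 h𝒜 => ?_⟩
  obtain ⟨j, rfl, -⟩ := hcs 𝒜 []
  have hcap : Capturing (c j) (stage z j) := capturing_of_requirements hz1 hs' hz2 j h𝒜
  refine ⟨selection (c j) (stage z j), fun F hF hFZ => ?_⟩
  obtain ⟨i, hi⟩ := exists_subset_stage hs' hinj hF hFZ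
  obtain ⟨n, hn⟩ := hcap.exists_captures hI hz2 i F hF hi ∅ finite_empty
  exact ⟨n, hn.1⟩

end Recursion

theorem Cardinal.mk_node_codes : Cardinal.mk (ℕ → ℕ → Set Node) = Cardinal.continuum := by
  simp [Cardinal.mk_set]

theorem exists_selectiveBranches (CH : Cardinal.continuum.{0} = Cardinal.aleph.{0} 1) :
    ∃ Z : Set Branch, ¬ Z.Countable ∧ SelectiveBranches Z := by
  have hcard : Cardinal.mk ((ℕ → ℕ → Set Node) × Node) = Cardinal.mk (Cardinal.aleph.{0} 1).out := by
    rw [Cardinal.mk_out, ← CH, Cardinal.mk_prod, Cardinal.mk_node_codes]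
    simp
  obtain ⟨e⟩ := Cardinal.eq.1 hcard
  generalize hI' : (Cardinal.aleph.{0} 1).out = I at e
  have hmk : Cardinal.mk I = Cardinal.aleph 1 := by rw [← hI', Cardinal.mk_out]
  obtain ⟨_, _, htype⟩ := Cardinal.exists_ord_eq_type_lt I
  have hI : ∀ i : I, (Iio i).Countable := by
    intro i
    have h1 := Ordinal.typein_lt_type (α := I) (· < ·) i
    rw [← htype, Cardinal.lt_ord, ← Ordinal.type_Iio_lt, Ordinal.card_type, hmk,
      ← Cardinal.succ_aleph0, Order.lt_succ_iff] at h1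
    exact Cardinal.le_aleph0_iff_set_countable.1 h1
  -- Each node is paired with continuum many sequences, too many indices for a countable initial
  -- segment.
  have hs' : ∀ (t : Node) (j : I), ∃ i : I, j ≤ i ∧ (e.symm i).2 = t := by
    intro t j
    by_contra! hcon
    have hsub : range (fun a => e (a, t)) ⊆ Iio j := by
      rintro _ ⟨a, rfl⟩
      exact lt_of_not_ge fun hja => hcon (e (a, t)) hja (by simp)
    have hc := (hI j).mono hsub
    have hinj : Function.Injective fun a => e (a, t) :=
      e.injective.comp (Prod.mk_left_injective t)
    rw [← Cardinal.le_aleph0_iff_set_countable, Cardinal.mk_range_eq _ hinj,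
      Cardinal.mk_node_codes] at hc
    exact Cardinal.aleph0_lt_continuum.not_ge hc
  have : Nonempty I := ⟨e (fun _ _ => ∅, [])⟩
  obtain ⟨z, hinj, hz⟩ := exists_selectiveBranches_of_order (c := fun i => (e.symm i).1)
    (s := fun i => (e.symm i).2) hI (fun 𝒜 t => ⟨e (𝒜, t), by simp, by simp⟩) hs'
  refine ⟨range z, fun hc => ?_, hz⟩
  rw [← Cardinal.le_aleph0_iff_set_countable, Cardinal.mk_range_eq _ hinj, hmk] at hc
  exact Cardinal.aleph0_lt_aleph_one.not_ge hc

/-! ### The Cantor tree space -/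

/-- The nodes and branches of the Cantor tree, with the topology in which the nodes are isolated and
the restrictions of a branch converge to it. -/
def CantorTree : Type := Node ⊕ Branch

namespace CantorTree

/-- A node as a point of the Cantor tree. -/
def node (t : Node) : CantorTree := Sum.inl t

/-- A branch as a point of the Cantor tree. -/
def branch (x : Branch) : CantorTree := Sum.inr x

instance : TopologicalSpace CantorTree where
  IsOpen U := ∀ x, branch x ∈ U → ∀ᶠ k in atTop, node (PiNat.res x k) ∈ U
  isOpen_univ := by simp
  isOpen_inter U V hU hV x hx := (hU x hx.1).and (hV x hx.2)
  isOpen_sUnion 𝒰 h x := by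
    rintro ⟨U, hU, hx⟩
    exact (h U hU x hx).mono fun k hk => ⟨U, hU, hk⟩

theorem isOpen_def {U : Set CantorTree} :
    IsOpen U ↔ ∀ x, branch x ∈ U → ∀ᶠ k in atTop, node (PiNat.res x k) ∈ U := Iff.rfl

theorem tendsto_branch (x : Branch) :
    Tendsto (fun k => node (PiNat.res x k)) atTop (𝓝 (branch x)) := by
  rw [tendsto_nhds]
  exact fun U hU hx => hU x hx

theorem node_injective : Function.Injective node := Sum.inl_injective

theorem branch_injective : Function.Injective branch := Sum.inr_injective

theorem node_ne_branch (t : Node) (x : Branch) : node t ≠ branch x := Sum.inl_ne_inr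

theorem branch_ne_node (t : Node) (x : Branch) : branch x ≠ node t := Sum.inr_ne_inl

theorem exists_eq (p : CantorTree) : (∃ t, p = node t) ∨ ∃ x, p = branch x := by
  rcases p with t | x
  · exact .inl ⟨t, rfl⟩
  · exact .inr ⟨x, rfl⟩

/-- The map recording which nodes are below a given point. -/
def below : CantorTree → Node → Bool
  | .inl t, s => decide (s <:+ t)
  | .inr x, s => decide (PiNat.res x s.length = s)

@[simp]
theorem below_node {t s : Node} : below (node t) s = true ↔ s <:+ t := by
  simp [below, node]

@[simp]
theorem below_branch {x : Branch} {s : Node} :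
    below (branch x) s = true ↔ PiNat.res x s.length = s := by
  simp [below, branch]

/-- Whether `PiNat.res x k` extends `s` no longer depends on `k` once `k` reaches the length of `s`.
-/
theorem continuous_below : Continuous below := by
  refine continuous_pi fun s => ⟨fun V _ => ?_⟩
  rw [isOpen_def]
  intro x hx
  filter_upwards [eventually_ge_atTop s.length] with k hk
  have : below (node (PiNat.res x k)) s = below (branch x) s := by
    rw [Bool.eq_iff_iff, below_node, below_branch, PiNat.suffix_res_iff x hk]
  rwa [mem_preimage, this]

theorem not_below_node_eq_below_branch (t : Node) (x : Branch) : below (node t) ≠ below (branch x) := by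
  intro h
  have h1 : below (branch x) (PiNat.res x (t.length + 1)) = true := by simp
  rw [← h, below_node] at h1
  simpa using h1.length_le

theorem below_injective : Function.Injective below := by
  intro p q h
  rcases exists_eq p with ⟨t, rfl⟩ | ⟨x, rfl⟩ <;> rcases exists_eq q with ⟨u, rfl⟩ | ⟨y, rfl⟩
  · have h1 : t <:+ u := by rw [← below_node, ← h, below_node]
    have h2 : u <:+ t := by rw [← below_node, h, below_node]
    rw [h1.eq_of_length_le h2.length_le]
  · exact absurd h (not_below_node_eq_below_branch t y)
  · exact absurd h.symm (not_below_node_eq_below_branch u x)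
  · have h1 : ∀ n, PiNat.res y n = PiNat.res x n := by
      intro n
      have h2 : below (branch x) (PiNat.res x n) = true := by simp
      rw [h, below_branch] at h2
      simpa using h2
    rw [PiNat.res_injective (funext h1)]

theorem isClopen_singleton_node (t : Node) : IsClopen {node t} := by
  constructor
  · rw [← isOpen_compl_iff, isOpen_def]
    intro x _
    filter_upwards [eventually_gt_atTop t.length] with k hk h
    have := congrArg List.length (node_injective h)
    simp at this
    omega
  · rw [isOpen_def]
    exact fun x hx => absurd hx (branch_ne_node t x)

/-- The basic neighbourhoods of a branch. -/
def tail (x : Branch) (m : ℕ) : Set CantorTree :=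
  insert (branch x) ((fun k => node (PiNat.res x k)) '' Ici m)

theorem isClopen_tail (x : Branch) (m : ℕ) : IsClopen (tail x m) := by
  constructor
  · rw [← isOpen_compl_iff, isOpen_def]
    intro y hy
    have hyx : y ≠ x := fun h => hy (.inl (congrArg branch h))
    obtain ⟨l, hl⟩ := Function.ne_iff.1 hyx
    -- Beyond a place `l` where they differ, the two branches share no restriction.
    filter_upwards [eventually_gt_atTop l] with k hk
    rintro (h | ⟨i, -, h⟩)
    · exact node_ne_branch _ _ h
    · have h' := node_injective h
      obtain rfl : i = k := by simpa using congrArg List.length h'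
      exact hl (PiNat.res_eq_res.1 h' hk).symm
  · rw [isOpen_def]
    rintro y (h | ⟨i, -, h⟩)
    · rw [branch_injective h]
      filter_upwards [eventually_ge_atTop m] with k hk
      exact .inr ⟨k, hk, rfl⟩
    · exact absurd h (node_ne_branch _ _)

instance : T35Space CantorTree where
  t0 := (t0Space_of_injective_of_continuous below_injective continuous_below).t0
  completely_regular := by
    refine (CompletelyRegularSpace.of_isTopologicalBasis_clopens ?_).completely_regular
    refine TopologicalSpace.isTopologicalBasis_of_isOpen_of_nhds (fun s hs => hs.isOpen) ?_
    intro p U hp hU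
    rcases exists_eq p with ⟨t, rfl⟩ | ⟨x, rfl⟩
    · exact ⟨_, isClopen_singleton_node t, rfl, singleton_subset_iff.2 hp⟩
    · obtain ⟨m, hm⟩ := eventually_atTop.1 (hU x hp)
      refine ⟨_, isClopen_tail x m, mem_insert _ _, insert_subset hp ?_⟩
      rintro _ ⟨k, hk, rfl⟩
      exact hm k hk

end CantorTree

/-- The subspace of the Cantor tree on all nodes and the branches in `Z`. -/
abbrev TreeSpace (Z : Set Branch) : Type :=
  {p : CantorTree // p ∈ (treePoints Z : Set (Node ⊕ Branch))}

namespace TreeSpace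

open CantorTree

variable {Z : Set Branch}

/-- A node as a point of the tree space. -/
def ofNode (Z : Set Branch) (t : Node) : TreeSpace Z := ⟨node t, .inl ⟨t, rfl⟩⟩

/-- A branch in `Z` as a point of the tree space. -/
def ofBranch (x : Z) : TreeSpace Z := ⟨branch x, .inr ⟨x, x.2, rfl⟩⟩

theorem exists_eq (p : TreeSpace Z) : (∃ t, p = ofNode Z t) ∨ ∃ x, p = ofBranch x := by
  obtain ⟨p, ⟨t, rfl⟩ | ⟨x, hx, rfl⟩⟩ := p
  · exact .inl ⟨t, rfl⟩
  · exact .inr ⟨⟨x, hx⟩, rfl⟩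

theorem ofBranch_injective : Function.Injective (ofBranch (Z := Z)) := fun _ _ h =>
  Subtype.ext (branch_injective (congrArg Subtype.val h))

theorem tendsto_ofBranch (x : Z) :
    Tendsto (fun k => ofNode Z (PiNat.res x k)) atTop (𝓝 (ofBranch x)) :=
  tendsto_subtype_rng.2 (tendsto_branch x)

theorem continuous_below : Continuous fun p : TreeSpace Z => below p :=
  CantorTree.continuous_below.comp continuous_subtype_val

theorem below_injective : Function.Injective fun p : TreeSpace Z => below p :=
  CantorTree.below_injective.comp Subtype.val_injective

/-- Together with `mem_closure_of_almostIn`, this lets the trace of an open set on the nodes stand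
for the set itself, at the cost of passing to the closure. -/
theorem almostIn_of_mem_open {Y : Type*} [TopologicalSpace Y] {f : TreeSpace Z → Y}
    (hf : Continuous f) {W : Set Y} (hW : IsOpen W) (p : TreeSpace Z) (hp : f p ∈ W) :
    AlmostIn {t | f (ofNode Z t) ∈ W} p.1 := by
  rcases exists_eq p with ⟨t, rfl⟩ | ⟨x, rfl⟩
  · exact hp
  · exact ((hf.tendsto _).comp (tendsto_ofBranch x)).eventually (hW.mem_nhds hp)

theorem mem_closure_of_almostIn {Y : Type*} [TopologicalSpace Y] {f : TreeSpace Z → Y}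
    (hf : Continuous f) {W : Set Y} (p : TreeSpace Z)
    (hp : AlmostIn {t | f (ofNode Z t) ∈ W} p.1) : f p ∈ closure W := by
  rcases exists_eq p with ⟨t, rfl⟩ | ⟨x, rfl⟩
  · exact subset_closure hp
  · exact mem_closure_of_tendsto ((hf.tendsto _).comp (tendsto_ofBranch x)) hp

theorem hasCoarserSecondCountableTopology (Z : Set Branch) :
    HasCoarserSecondCountableTopology (TreeSpace Z) := by
  refine ⟨TopologicalSpace.induced (fun p : TreeSpace Z => below p) inferInstance,
    continuous_iff_le_induced.1 continuous_below, ?_, ?_⟩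
  · let _ : TopologicalSpace (TreeSpace Z) :=
      TopologicalSpace.induced (fun p : TreeSpace Z => below p) inferInstance
    exact Topology.IsEmbedding.t35Space (f := fun p : TreeSpace Z => below p)
      ⟨⟨rfl⟩, below_injective⟩
  · exact TopologicalSpace.secondCountableTopology_induced _ _ _

/-- Any set containing all nodes is open. Each `U F` contains only finitely many branches, so a
sequence of them misses a branch of the uncountable `Z`. -/
theorem not_isS1OmegaOmega (hZ : ¬ Z.Countable) : ¬ IsS1OmegaOmega (TreeSpace Z) := by
  intro h
  let U (F : Set (TreeSpace Z)) : Set (TreeSpace Z) := range (ofNode Z) ∪ F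
  have hmem : {V | ∃ F, F.Finite ∧ V = U F} ∈ OpenOmegaCovers (TreeSpace Z) := by
    refine ⟨?_, ?_, fun F hF => ⟨U F, ⟨F, hF, rfl⟩, subset_union_right⟩⟩
    · rintro _ ⟨F, -, rfl⟩
      refine ⟨Subtype.val '' U F ∪ range node, ?_, ?_⟩
      · exact fun x _ => Eventually.of_forall fun k => .inr ⟨_, rfl⟩
      · ext p
        constructor
        · rintro (⟨q, hq, hqp⟩ | ⟨t, ht⟩)
          · rwa [← Subtype.ext hqp]
          · exact .inl ⟨t, Subtype.ext ht⟩
        · exact fun hp => .inl ⟨p, hp, rfl⟩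
    · rintro ⟨F, hF, hFU⟩
      refine hZ (Finite.countable ?_)
      have hfin : Finite Z := by
        have := hF.preimage ofBranch_injective.injOn
        rw [← finite_univ_iff]
        refine this.subset fun x _ => ?_
        rcases hFU ▸ mem_univ (ofBranch x) with ⟨t, ht⟩ | hx
        · exact absurd (congrArg Subtype.val ht) (node_ne_branch t x)
        · exact hx
      exact Z.toFinite
  obtain ⟨b, hb, hcov⟩ := h (fun _ => _) fun _ => hmem
  choose F hF hbF using hb
  refine hZ ?_
  have hc : (⋃ n, F n).Countable := countable_iUnion fun n => (hF n).countable
  have huniv : (univ : Set Z) ⊆ ofBranch ⁻¹' ⋃ n, F n := by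
    intro x _
    obtain ⟨_, ⟨n, rfl⟩, hn⟩ := hcov.2.2 {ofBranch x} (finite_singleton _)
    rw [hbF] at hn
    rcases hn rfl with ⟨t, ht⟩ | hx
    · exact absurd (congrArg Subtype.val ht) (node_ne_branch t x)
    · exact mem_iUnion.2 ⟨n, hx⟩
  exact countable_coe_iff.1 (countable_univ_iff.1
    ((hc.preimage_of_injOn ofBranch_injective.injOn).mono huniv))

theorem isProjectivelyS1OmegaOmega (hZ : SelectiveBranches Z) :
    IsProjectivelyS1OmegaOmega (TreeSpace Z) := by
  intro Y _ _ _ f hf hsurj 𝒱 h𝒱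
  let B := TopologicalSpace.countableBasis Y
  have hB : TopologicalSpace.IsTopologicalBasis B := TopologicalSpace.isBasis_countableBasis Y
  -- Finite unions of basic sets make the families countable; the closure inside `V` absorbs the
  -- loss in returning from traces to open sets.
  let 𝒲 (n : ℕ) : Set (Set (Set Y)) :=
    {G | (G.Finite ∧ G ⊆ B) ∧ ∃ V ∈ 𝒱 n, closure (⋃₀ G) ⊆ V}
  have hfine : ∀ n, ∀ F : Set Y, F.Finite → ∃ G ∈ 𝒲 n, F ⊆ ⋃₀ G := by
    intro n F hF
    obtain ⟨V, hV, hFV⟩ := (h𝒱 n).2.2 F hF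
    have hVo := (h𝒱 n).1 V hV
    have : ∀ y ∈ F, ∃ W ∈ B, y ∈ W ∧ closure W ⊆ V := by
      intro y hy
      exact hB.exists_closure_subset (hVo.mem_nhds (hFV hy))
    choose! W hWB hyW hWV using this
    refine ⟨W '' F, ⟨⟨hF.image W, image_subset_iff.2 hWB⟩, V, hV, ?_⟩,
      fun y hy => ⟨W y, ⟨y, hy, rfl⟩, hyW y hy⟩⟩
    rw [(hF.image W).closure_sUnion]
    simpa using hWV
  have hcount : ∀ n, (𝒲 n).Countable := fun n =>
    (countable_ofPred_finite_subset (TopologicalSpace.countable_countableBasis Y)).mono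
      fun G hG => hG.1
  have hne : ∀ n, (𝒲 n).Nonempty := fun n =>
    let ⟨G, hG, _⟩ := hfine n ∅ finite_empty
    ⟨G, hG⟩
  choose G hG using fun n => (hcount n).exists_eq_range (hne n)
  have hGmem : ∀ n i, G n i ∈ 𝒲 n := fun n i => hG n ▸ mem_range_self i
  have hopen : ∀ n i, IsOpen (⋃₀ G n i) := fun n i =>
    isOpen_sUnion fun W hW => hB.isOpen ((hGmem n i).1.2 hW)
  obtain ⟨g, hg⟩ := hZ (fun n i => {t | f (ofNode Z t) ∈ ⋃₀ G n i}) (by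
    intro n F hF hFZ
    let F' : Set (TreeSpace Z) := {p | p.1 ∈ (F : Set CantorTree)}
    have hF' : F'.Finite := hF.preimage Subtype.val_injective.injOn
    obtain ⟨_, hGn, hsub⟩ := hfine n (f '' F') (hF'.image f)
    obtain ⟨i, rfl⟩ := hG n ▸ hGn
    exact ⟨i, fun p hp => almostIn_of_mem_open hf (hopen n i) ⟨p, hFZ hp⟩ (hsub ⟨_, hp, rfl⟩)⟩)
  choose V hV hGV using fun n => (hGmem n (g n)).2
  refine ⟨V, hV, ?_, ?_, ?_⟩
  · rintro _ ⟨n, rfl⟩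
    exact (h𝒱 n).1 _ (hV n)
  · rintro ⟨n, hn⟩
    exact (h𝒱 n).2.1 (hn ▸ hV n)
  · intro F hF
    obtain ⟨e, he⟩ := hsurj.hasRightInverse
    obtain ⟨n, hn⟩ := hg ((fun y => (e y).1) '' F) (hF.image _)
      (image_subset_iff.2 fun y _ => (e y).2)
    refine ⟨V n, ⟨n, rfl⟩, fun y hy => hGV n ?_⟩
    have := mem_closure_of_almostIn hf (e y) (hn _ ⟨y, hy, rfl⟩)
    rwa [he] at this

end TreeSpace

/-! ### Function spaces -/

/-- Phrased for inducing maps so as to cover both C_p(X) and its subspaces. -/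
theorem Topology.IsInducing.mem_closure_iff_finite_approx {X A : Type*} [TopologicalSpace A]
    {ι : A → X → ℝ} (hι : IsInducing ι) {D : Set A} {g : A} :
    g ∈ closure D ↔ ∀ F : Set X, F.Finite → ∀ ε > 0, ∃ h ∈ D, ∀ x ∈ F, |ι h x - ι g x| < ε := by
  rw [hι.closure_eq_preimage_closure_image, mem_preimage, mem_closure_iff]
  constructor
  · intro h F hF ε hε
    have ho : IsOpen (F.pi fun x => Metric.ball (ι g x) ε) :=
      isOpen_set_pi hF fun _ _ => Metric.isOpen_ball
    obtain ⟨_, hk, ⟨k, hkD, rfl⟩⟩ := h _ ho fun x _ => Metric.mem_ball_self hε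
    exact ⟨k, hkD, fun x hx => by simpa [Real.dist_eq] using hk x hx⟩
  · intro h O hO hg
    obtain ⟨J, u, hu, hJ⟩ := isOpen_pi_iff.1 hO _ hg
    have : ∀ᶠ ε in 𝓝[>] (0 : ℝ), ∀ x ∈ J, Metric.ball (ι g x) ε ⊆ u x := by
      rw [Finset.eventually_all]
      intro x hx
      obtain ⟨δ, hδ, hδu⟩ := Metric.isOpen_iff.1 (hu x hx).1 _ (hu x hx).2
      filter_upwards [Ioo_mem_nhdsGT hδ] with ε hε
      exact (Metric.ball_subset_ball hε.2.le).trans hδu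
    obtain ⟨ε, hε, hε0⟩ := (this.and self_mem_nhdsWithin).exists
    obtain ⟨k, hkD, hk⟩ := h J J.finite_toSet ε hε0
    exact ⟨ι k, hJ fun x hx => hε x hx (by simpa [Real.dist_eq] using hk x hx), ⟨k, hkD, rfl⟩⟩

theorem Topology.IsInducing.dense_iff_finite_approx {X A : Type*} [TopologicalSpace A]
    {ι : A → X → ℝ} (hι : IsInducing ι) {D : Set A} :
    Dense D ↔ ∀ g, ∀ F : Set X, F.Finite → ∀ ε > 0, ∃ h ∈ D, ∀ x ∈ F, |ι h x - ι g x| < ε :=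
  forall_congr' fun _ => hι.mem_closure_iff_finite_approx

/-- A product of separating functions gives `φ` vanishing on `F` and equal to 1 off `U`; then `φ +
(1 - φ) * g` interpolates between `g` and 1. -/
theorem exists_continuous_eqOn_of_mem_open {X : Type*} [TopologicalSpace X] [T35Space X]
    {F U : Set X} (hF : F.Finite) (hU : IsOpen U) (hFU : F ⊆ U) {g : X → ℝ} (hg : Continuous g) :
    ∃ f : X → ℝ, Continuous f ∧ EqOn f g F ∧ ∀ x ∉ U, f x = 1 := by
  have hφ : ∃ φ : X → ℝ, Continuous φ ∧ (∀ x ∈ F, φ x = 0) ∧ ∀ x ∉ U, φ x = 1 := by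
    have : ∀ x ∈ F, ∃ φ : X → ℝ, Continuous φ ∧ φ x = 0 ∧ ∀ y ∉ U, φ y = 1 := by
      intro x hx
      obtain ⟨φ, hφ, hφ0, hφ1⟩ :=
        CompletelyRegularSpace.completely_regular_isOpen x U hU (hFU hx)
      exact ⟨fun y => φ y, continuous_subtype_val.comp hφ, by simp [hφ0],
        fun y hy => by simp [hφ1 hy]⟩
    choose! φ hφ hφ0 hφ1 using this
    refine ⟨fun y => ∏ x ∈ hF.toFinset, φ x y, ?_, fun x hx => ?_, fun y hy => ?_⟩
    · exact continuous_finsetProd _ fun x hx => hφ x (hF.mem_toFinset.1 hx)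
    · exact Finset.prod_eq_zero (hF.mem_toFinset.2 hx) (hφ0 x hx)
    · exact Finset.prod_eq_one fun x hx => hφ1 x (hF.mem_toFinset.1 hx) y hy
  obtain ⟨φ, hφ, hφ0, hφ1⟩ := hφ
  refine ⟨fun x => φ x + (1 - φ x) * g x, by fun_prop, fun x hx => ?_, fun x hx => ?_⟩
  · simp [hφ0 x hx]
  · simp [hφ1 x hx]

/-- The functions equal to 1 off some member of `𝒰 n` are dense. A selected one that is within 1 of
zero on `F` has `F` inside its member. -/
theorem RSeparable.isS1OmegaOmega {X : Type*} [TopologicalSpace X] [T35Space X]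
    (h : RSeparable (Cp X)) : IsS1OmegaOmega X := by
  intro 𝒰 h𝒰
  have hι : IsInducing (Subtype.val : Cp X → X → ℝ) := IsInducing.subtypeVal
  have hD : ∀ n, Dense {f : Cp X | ∃ U ∈ 𝒰 n, ∀ x ∉ U, f.1 x = 1} := by
    intro n
    rw [hι.dense_iff_finite_approx]
    intro g F hF ε hε
    obtain ⟨U, hU, hFU⟩ := (h𝒰 n).2.2 F hF
    obtain ⟨f, hf, hfg, hf1⟩ :=
      exists_continuous_eqOn_of_mem_open hF ((h𝒰 n).1 U hU) hFU g.2
    exact ⟨⟨f, hf⟩, ⟨U, hU, hf1⟩, fun x hx => by simpa [hfg hx] using hε⟩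
  obtain ⟨p, hp, hpd⟩ := h _ hD
  choose U hU hpU using hp
  refine ⟨U, hU, ?_, ?_, fun F hF => ?_⟩
  · rintro _ ⟨n, rfl⟩
    exact (h𝒰 n).1 _ (hU n)
  · rintro ⟨n, hn⟩
    exact (h𝒰 n).2.1 (hn ▸ hU n)
  · obtain ⟨_, ⟨n, rfl⟩, hn⟩ :=
      hι.dense_iff_finite_approx.1 hpd ⟨fun _ => 0, continuous_const⟩ F hF 1 one_pos
    refine ⟨U n, ⟨n, rfl⟩, fun x hx => ?_⟩
    by_contra hxU
    have := hn x hx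
    rw [hpU n x hxU] at this
    simp at this

/-- Strong fan tightness at zero of the continuous functions on a space with `S₁(Ω, Ω)`. -/
theorem IsS1OmegaOmega.exists_approx {Y : Type*} [TopologicalSpace Y] (hY : IsS1OmegaOmega Y)
    {D : ℕ → Set (Y → ℝ)} (hDc : ∀ n, ∀ g ∈ D n, Continuous g)
    (hD : ∀ n, ∀ F : Set Y, F.Finite → ∀ ε > 0, ∃ g ∈ D n, ∀ y ∈ F, |g y| < ε) :
    ∃ g : ℕ → Y → ℝ, (∀ n, g n ∈ D n) ∧
      ∀ F : Set Y, F.Finite → ∀ ε > 0, ∃ n, ∀ y ∈ F, |g n y| < ε := by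
  classical
  let tol (n : ℕ) : ℝ := 1 / ((n : ℝ) + 1)
  have htol : ∀ n, 0 < tol n := fun n => Nat.one_div_pos_of_nat
  let U (n : ℕ) (g : Y → ℝ) : Set Y := {y | |g y| < tol n}
  choose d hd _ using fun n => hD n ∅ finite_empty 1 one_pos
  have hsmall : ∀ ε > 0, ∃ N, ∀ n ≥ N, tol n < ε := by
    intro ε hε
    exact eventually_atTop.1
      ((tendsto_one_div_add_atTop_nhds_zero_nat (𝕜 := ℝ)).eventually_lt_const hε)
  -- An ω-cover may not contain the whole space. If `U n g` is the whole space for infinitely many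
  -- `n`, such `g` are uniformly small and suffice; otherwise the sets `U n g` form ω-covers from
  -- some `N` on.
  by_cases hfreq : ∀ N, ∃ n ≥ N, ∃ g ∈ D n, U n g = univ
  · refine ⟨fun n => if h : ∃ g ∈ D n, U n g = univ then h.choose else d n, fun n => ?_, ?_⟩
    · dsimp only
      split_ifs with h
      · exact h.choose_spec.1
      · exact hd n
    · intro F _ ε hε
      obtain ⟨N, hN⟩ := hsmall ε hε
      obtain ⟨n, hn, h⟩ := hfreq N
      refine ⟨n, fun y _ => ?_⟩
      simp only [dif_pos h]
      have : y ∈ U n h.choose := eq_univ_iff_forall.1 h.choose_spec.2 y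
      exact lt_trans this (hN n hn)
  · push Not at hfreq
    obtain ⟨N, hN⟩ := hfreq
    have hcov : ∀ n, U (N + n) '' D (N + n) ∈ OpenOmegaCovers Y := by
      refine fun n => ⟨?_, ?_, fun F hF => ?_⟩
      · rintro _ ⟨g, hg, rfl⟩
        exact isOpen_lt (hDc _ g hg).abs continuous_const
      · rintro ⟨g, hg, hgu⟩
        exact hN _ (Nat.le_add_right _ _) g hg hgu
      · obtain ⟨g, hg, hgF⟩ := hD (N + n) F hF _ (htol (N + n))
        exact ⟨_, ⟨g, hg, rfl⟩, hgF⟩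
    obtain ⟨b, hb, hbc⟩ := hY _ hcov
    choose g hg hgb using hb
    refine ⟨fun n => if h : N ≤ n then g (n - N) else d n, fun n => ?_, fun F hF ε hε => ?_⟩
    · dsimp only
      split_ifs with h
      · have := hg (n - N)
        rwa [Nat.add_sub_cancel' h] at this
      · exact hd n
    · obtain ⟨K, hK⟩ := hsmall ε hε
      have hne : ∀ n, ∃ y, y ∉ b n := fun n =>
        (ne_univ_iff_exists_notMem _).1 fun h => hbc.2.1 (h ▸ mem_range_self n)
      choose y hy using hne
      -- Adding a point missed by each of the first `K` selected sets forces an index at least `K`,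
      -- hence a tolerance below `ε`.
      obtain ⟨_, ⟨n, rfl⟩, hn⟩ := hbc.2.2 (F ∪ y '' Iio K) (hF.union ((finite_Iio K).image y))
      have hKn : K ≤ n := not_lt.1 fun hnK => hy n (hn (.inr ⟨n, hnK, rfl⟩))
      refine ⟨N + n, fun x hx => ?_⟩
      have hx' : x ∈ U (N + n) (g n) := by
        rw [hgb]
        exact hn (.inl hx)
      simpa using lt_trans hx' (hK _ (hKn.trans (Nat.le_add_left _ _)))

theorem IsProjectivelyS1OmegaOmega.rSeparable {X : Type*} [TopologicalSpace X]
    (hX : IsProjectivelyS1OmegaOmega X) {M : Set (Cp X)} (hM : M.Countable) (hMd : Dense M) :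
    RSeparable M := by
  intro D hD
  have : Countable M := hM
  have hne : Nonempty M := (hMd.nonempty (h := ⟨⟨fun _ => 0, continuous_const⟩⟩)).to_subtype
  let Φ (x : X) (m : M) : ℝ := m.1.1 x
  have hΦ : Continuous Φ := continuous_pi fun m => m.1.2
  have hY : IsS1OmegaOmega (range Φ) :=
    hX (range Φ) (rangeFactorization Φ) (hΦ.subtype_mk _) rangeFactorization_surjective
  have hι : IsInducing fun m : M => m.1.1 := IsInducing.subtypeVal.comp IsInducing.subtypeVal
  -- Strong fan tightness of `M` at `m`: the differences with `m` are read as coordinate functions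
  -- on `range Φ` and approximate zero there.
  have key : ∀ (m : M) (E : ℕ → Set M), (∀ n, Dense (E n)) →
      ∃ e : ℕ → M, (∀ n, e n ∈ E n) ∧ m ∈ closure (range e) := by
    intro m E hE
    obtain ⟨g, hg, hgF⟩ := hY.exists_approx
      (D := fun n => (fun (e : M) (y : range Φ) => y.1 e - y.1 m) '' E n) (by
        rintro n _ ⟨e, -, rfl⟩
        exact ((continuous_apply e).comp continuous_subtype_val).sub
          ((continuous_apply m).comp continuous_subtype_val)) (by
        intro n F hF ε hε
        choose x hx using fun y : range Φ => y.2
        obtain ⟨e, he, heF⟩ := hι.dense_iff_finite_approx.1 (hE n) m (x '' F) (hF.image x) ε hε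
        refine ⟨_, ⟨e, he, rfl⟩, fun y hy => ?_⟩
        have := heF _ ⟨y, hy, rfl⟩
        change |y.1 e - y.1 m| < ε
        rwa [← hx y])
    choose e he heg using hg
    refine ⟨e, he, hι.mem_closure_iff_finite_approx.2 fun F hF ε hε => ?_⟩
    obtain ⟨n, hn⟩ := hgF (rangeFactorization Φ '' F) (hF.image _) ε hε
    refine ⟨e n, ⟨n, rfl⟩, fun x hx => ?_⟩
    have := hn _ ⟨x, hx, rfl⟩
    rwa [← heg] at this
  obtain ⟨enum, henum⟩ := exists_surjective_nat M
  -- The indices split into infinitely many rows, the `k`-th devoted to approaching the `k`-th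
  -- element of `M`.
  choose e he hec using fun k => key (enum k) (fun j => D (Nat.pair k j)) fun j => hD _
  refine ⟨fun n => e n.unpair.1 n.unpair.2, fun n => ?_, fun m => ?_⟩
  · have := he n.unpair.1 n.unpair.2
    rwa [Nat.pair_unpair] at this
  · obtain ⟨k, rfl⟩ := henum m
    refine closure_mono ?_ (hec k)
    rintro _ ⟨j, rfl⟩
    exact ⟨Nat.pair k j, by simp⟩

/-- C(K, ℝ) is separable, and composition with `φ` has dense range: by injectivity of `φ`, values on
a finite subset of `X` transfer to a finite, hence closed, subset of `K`, where Tietze's theorem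
extends them. -/
theorem exists_countable_dense_cp {X K : Type*} [TopologicalSpace X] [TopologicalSpace K]
    [CompactSpace K] [T2Space K] [SecondCountableTopology K] {φ : X → K} (hφ : Continuous φ)
    (hinj : Function.Injective φ) : ∃ M : Set (Cp X), M.Countable ∧ Dense M := by
  let Ψ (h : C(K, ℝ)) : Cp X := ⟨h ∘ φ, h.continuous.comp hφ⟩
  have hΨ : Continuous Ψ := by
    refine Continuous.subtype_mk (continuous_pi fun x => ?_) _
    exact continuous_eval_const (φ x)
  have hdense : DenseRange Ψ := by
    have hι : IsInducing (Subtype.val : Cp X → X → ℝ) := IsInducing.subtypeVal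
    refine hι.dense_iff_finite_approx.2 ?_
    intro g F hF ε hε
    have hfin : Finite (φ '' F) := (hF.image φ).to_subtype
    obtain ⟨h, hh⟩ := ContinuousMap.exists_restrict_eq (hF.image φ).isClosed
      ⟨fun y : φ '' F => g.1 y.2.choose, continuous_of_discreteTopology⟩
    refine ⟨Ψ h, ⟨h, rfl⟩, fun x hx => ?_⟩
    have hy : φ x ∈ φ '' F := ⟨x, hx, rfl⟩
    have h1 : h (φ x) = g.1 hy.choose := DFunLike.congr_fun hh ⟨φ x, hy⟩
    have h2 : hy.choose = x := hinj hy.choose_spec.2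
    have h3 : (Ψ h).1 x = g.1 x := by rw [← h2, ← h1, h2]; rfl
    simpa [h3] using hε
  obtain ⟨s, hs, hsd⟩ := TopologicalSpace.exists_countable_dense C(K, ℝ)
  exact ⟨Ψ '' s, hs.image Ψ, hdense.dense_image hΨ hsd⟩

theorem mainTheorem12 (CH : Cardinal.continuum.{0} = Cardinal.aleph.{0} 1) :
    ∃ (X : Type) (_ : TopologicalSpace X),
      T35Space X ∧
      HasCoarserSecondCountableTopology X ∧
      IsProjectivelyS1OmegaOmega X ∧
      ¬ IsS1OmegaOmega X ∧
      ¬ RSeparable (Cp X) ∧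
      (∀ M : Set (Cp X), M.Countable → Dense M → RSeparable M) ∧
      (∃ M : Set (Cp X), M.Countable ∧ Dense M ∧ RSeparable M) := by
  obtain ⟨Z, hZ, hsel⟩ := exists_selectiveBranches CH
  have hproj := TreeSpace.isProjectivelyS1OmegaOmega hsel
  have hnot := TreeSpace.not_isS1OmegaOmega hZ
  obtain ⟨M, hM, hMd⟩ := exists_countable_dense_cp
    (TreeSpace.continuous_below (Z := Z)) TreeSpace.below_injective
  exact ⟨TreeSpace Z, inferInstance, inferInstance, TreeSpace.hasCoarserSecondCountableTopology Z,
    hproj, hnot, fun h => hnot h.isS1OmegaOmega, fun M hM hMd => hproj.rSeparable hM hMd,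
    M, hM, hMd, hproj.rSeparable hM hMd⟩
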